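/- Let $\Theta\subset\mathbb{R}$ be non-empty and let $\{F_\theta:\theta\in\Theta\}$ be a family of distribution functions on $\mathbb{R}$ such that, for each $\theta\in\Theta$, there are $-\infty\le\alpha_\theta<\omega_\theta\le\infty$ for which the law with distribution function $F_\theta$ is concentrated on the open interval $(\alpha_\theta,\omega_\theta)$ and $F_\theta$ is continuous and strictly increasing on $(\alpha_\theta,\omega_\theta)$. Assume that each mean $\mu(\theta):=\int_{\alpha_\theta}^{\omega_\theta}x\,dF_\theta(x)$ exists and is finite and that, with $\mathcal{M}:=\bigcup_{\theta\in\Theta}(\alpha_\theta,\omega_\theta)$, for every $m\in\mathcal{M}$ the equation $\mu(\theta)=m$ has a unique solution $\theta\in\Theta$, denoted by $\mu^{-1}(m)$. For $\theta\in\Theta$ put $$\Lambda_\theta^*(x):=\sup_{\gamma\in\mathbb{R}}\{\gamma x-\Lambda_\theta(\gamma)\},\qquad \Lambda_\theta(\gamma):=\log\int_{\alpha_\theta}^{\omega_\theta}e^{\gamma x}\,dF_\theta(x)\in(-\infty,\infty].$$ Fix $\theta_0\in\Theta$, let $\{X_n:n\ge1\}$ be i.i.d. real random variables with distribution function $F_{\theta_0}$,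 let $\bar X_n:=\frac{X_1+\cdots+X_n}{n}$, and set $$J_{\theta_0}(\theta):=\begin{cases}\Lambda_{\theta_0}^*(\mu(\theta)) & \text{if }\theta\in\Theta\text{ and }\mu(\theta)\in(\alpha_{\theta_0},\omega_{\theta_0}),\\ \infty&\text{otherwise.}\end{cases}$$ Random variables $\{W_n:n\ge1\}$ with values in a topological space $\mathcal{W}$ satisfy the large deviation principle (LDP) with rate function $I:\mathcal{W}\to[0,\infty]$ if $I$ is lower semicontinuous, $\liminf_{n\to\infty}\frac1n\log P(W_n\in O)\ge-\inf_{w\in O}I(w)$ for all open $O\subset\mathcal{W}$, and $\limsup_{n\to\infty}\frac1n\log P(W_n\in C)\le-\inf_{w\in C}I(w)$ for all closed $C\subset\mathcal{W}$; a rate function $I$ is good if the sets $\{w\in\mathcal{W}:I(w)\le\eta\}$, $0\le\eta<\infty$, are compact. The following hold both with $\mathcal{W}=\Theta$ (with the subspace topology) and with $\mathcal{W}=\mathbb{R}$. (i) If there are $c_1,c_0\in\mathbb{R}$ with $c_1\ne0$ such that $\mu^{-1}(m)=c_1m+c_0$ for all $m\in\mathcal{M}$, then $\{\mu^{-1}(\bar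 X_n):n\ge1\}$ satisfies the LDP with rate function $J_{\theta_0}$. (ii) If the restriction of $\mu^{-1}$ to $(\alpha_{\theta_0},\omega_{\theta_0})$ is continuous and $\Lambda_{\theta_0}^*$ is a good rate function on $\mathbb{R}$, then $\{\mu^{-1}(\bar X_n):n\ge1\}$ satisfies the LDP with rate function $J_{\theta_0}$, and $J_{\theta_0}$ is a good rate function. -/

import Mathlib

open MeasureTheory ProbabilityTheory Filter Topology
open scoped ENNReal

noncomputable section

namespace MMEst

/-! ### Large deviation principles -/

/-- A rate function `I : 𝒲 → [0, ∞]`: nonnegative (as an extended real) and lower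
semicontinuous. -/
structure IsRateFunction {𝒲 : Type*} [TopologicalSpace 𝒲] (I : 𝒲 → EReal) : Prop where
  nonneg : ∀ w, 0 ≤ I w
  lowerSemicontinuous : LowerSemicontinuous I

/-- A rate function is good if all its level sets `{I ≤ η}`, `0 ≤ η < ∞`, are compact. -/
structure IsGoodRateFunction {𝒲 : Type*} [TopologicalSpace 𝒲] (I : 𝒲 → EReal) : Prop
    extends IsRateFunction I where
  isCompact_le : ∀ η : ℝ, 0 ≤ η → IsCompact {w | I w ≤ (η : EReal)}

/-- The random variables `W 1, W 2, …` (the value of `W` at `0` plays no role) satisfy the large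
deviation principle on the topological space `𝒲` with rate function `I`. Logarithms are taken in
the extended reals, with `log 0 = -∞`, and the infimum over the empty set is `+∞`. -/
structure SatisfiesLDP {Ω : Type*} [MeasurableSpace Ω] (P : Measure Ω)
    {𝒲 : Type*} [TopologicalSpace 𝒲] [MeasurableSpace 𝒲] (W : ℕ → Ω → 𝒲) (I : 𝒲 → EReal) :
    Prop where
  aemeasurable : ∀ n, 1 ≤ n → AEMeasurable (W n) P
  isRateFunction : IsRateFunction I
  lower_bound : ∀ O : Set 𝒲, IsOpen O →
    -(⨅ w ∈ O, I w) ≤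
      liminf (fun n : ℕ => ENNReal.log (P {ω | W n ω ∈ O}) / (n : EReal)) atTop
  upper_bound : ∀ C : Set 𝒲, IsClosed C →
    limsup (fun n : ℕ => ENNReal.log (P {ω | W n ω ∈ C}) / (n : EReal)) atTop ≤
      -(⨅ w ∈ C, I w)

/-! ### The statistical model -/

/-- The real points of the open interval with (possibly infinite) endpoints `a` and `b`. -/
def openInterval (a b : EReal) : Set ℝ := {x : ℝ | a < (x : EReal) ∧ (x : EReal) < b}

variable {Θ : Set ℝ}

/-- The mean `μ(θ)` of the law `F θ`. -/
def mean (F : Θ → Measure ℝ) (θ : Θ) : ℝ := ∫ x, x ∂(F θ)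

/-- The union over `θ ∈ Θ` of the intervals `(α θ, ω θ)`. -/
def meanSpace (α ω : Θ → EReal) : Set ℝ := ⋃ θ, openInterval (α θ) (ω θ)

/-- The family of laws `F θ`, `θ ∈ Θ ⊆ ℝ` (each given by a probability measure on `ℝ`), admits
moment-matching estimators: each `F θ` lives on an interval `(α θ, ω θ)`, on which its distribution
function is continuous and strictly increasing, it has a finite mean `μ(θ)`, and for every point `m`
of the union of the intervals the equation `μ(θ) = m` has a unique solution `θ ∈ Θ`. -/
structure MMCondition (F : Θ → Measure ℝ) (α ω : Θ → EReal) : Prop where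
  isProbabilityMeasure : ∀ θ, IsProbabilityMeasure (F θ)
  lt : ∀ θ, α θ < ω θ
  concentrated : ∀ θ, F θ (openInterval (α θ) (ω θ)) = 1
  continuousOn_cdf : ∀ θ, ContinuousOn (cdf (F θ)) (openInterval (α θ) (ω θ))
  strictMonoOn_cdf : ∀ θ, StrictMonoOn (cdf (F θ)) (openInterval (α θ) (ω θ))
  integrable : ∀ θ, Integrable (fun x : ℝ => x) (F θ)
  existsUnique_mean_eq : ∀ m ∈ meanSpace α ω, ∃! θ : Θ, mean F θ = m

/-- The inverse `μ⁻¹` of the mean function. Under `MMCondition`, `meanInv F m` is the unique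
`θ ∈ Θ` with `μ(θ) = m` for each `m` in `meanSpace α ω`; its values elsewhere are irrelevant, as the
sample means almost surely lie in `meanSpace α ω`. -/
def meanInv [Nonempty Θ] (F : Θ → Measure ℝ) : ℝ → Θ := Function.invFun (mean F)

/-- The logarithmic moment generating function `Λ(γ) = log ∫ exp (γ x) ν(dx)`, possibly `+∞`. -/
def logMGF (ν : Measure ℝ) (γ : ℝ) : EReal :=
  ENNReal.log (∫⁻ x, ENNReal.ofReal (Real.exp (γ * x)) ∂ν)

/-- The Legendre transform `Λ*(x) = sup_γ (γ x - Λ(γ))`. -/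
def logMGFStar (ν : Measure ℝ) (x : ℝ) : EReal :=
  ⨆ γ : ℝ, (((γ * x : ℝ) : EReal) - logMGF ν γ)

/-- The sample mean `(X₁ + ⋯ + Xₙ) / n`; the sample is indexed from `0`. -/
def sampleMean {Ω : Type*} (X : ℕ → Ω → ℝ) (n : ℕ) (ω : Ω) : ℝ :=
  (∑ i ∈ Finset.range n, X i ω) / (n : ℝ)

/-- The moment-matching estimator `μ⁻¹(X̄ₙ)`. -/
def mmEstimator [Nonempty Θ] {Ω : Type*} (F : Θ → Measure ℝ) (X : ℕ → Ω → ℝ) (n : ℕ) (ω : Ω) : Θ :=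
  meanInv F (sampleMean X n ω)

open Classical in
/-- The function `J_{θ₀}` on `Θ`: `Λ*_{θ₀}(μ(θ))` if `μ(θ) ∈ (α θ₀, ω θ₀)`, and `∞` otherwise. -/
def mmRate (F : Θ → Measure ℝ) (α ω : Θ → EReal) (θ₀ θ : Θ) : EReal :=
  if mean F θ ∈ openInterval (α θ₀) (ω θ₀) then logMGFStar (F θ₀) (mean F θ) else ⊤

open Classical in
/-- The function `J_{θ₀}` on the whole real line, equal to `∞` outside `Θ`. -/
def mmRateReal (F : Θ → Measure ℝ) (α ω : Θ → EReal) (θ₀ : Θ) (t : ℝ) : EReal :=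
  if h : t ∈ Θ then mmRate F α ω θ₀ ⟨t, h⟩ else ⊤

end MMEst

end

open MMEst

/-!
The sample means satisfy the large deviation principle with rate function `Λ*` (Cramér's theorem).
The upper bound is Chernoff's. For the lower bound at `x`, minimize `γ ↦ ∫ exp (γ (y - x)) ν(dy)`:
at an interior minimum the tilted law has mean `x`, so the weak law of large numbers and the density
of the change of measure give the bound. Truncation to compact intervals makes the minimum interior.
Almost surely all sample means lie in `(α θ₀, ω θ₀)`, and `Λ*` is infinite off this interval, so the
contraction principle applies along a `μ⁻¹` which is continuous there, and it preserves goodness.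
For an affine `μ⁻¹` the contracted rate function is `Λ*` composed with the inverse affine map, hence
lower semicontinuous.
-/

namespace MMEst

/-! ### The Legendre transform -/

/-- The exponential moment `∫ exp (γ (y - x)) ν(dy)` about the point `x`, possibly infinite; it is
`exp (Λ(γ) - γ x)`, so that `Λ*(x)` is minus the infimum over `γ` of its logarithm. -/
noncomputable def expMoment (ν : Measure ℝ) (γ x : ℝ) : ℝ≥0∞ :=
  ∫⁻ y, ENNReal.ofReal (Real.exp (γ * (y - x))) ∂ν

lemma coe_sub_logMGF (ν : Measure ℝ) (γ x : ℝ) :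
    ((γ * x : ℝ) : EReal) - logMGF ν γ = -ENNReal.log (expMoment ν γ x) := by
  have hfactor : expMoment ν γ x = ENNReal.ofReal (Real.exp (-(γ * x))) *
      ∫⁻ y, ENNReal.ofReal (Real.exp (γ * y)) ∂ν := by
    rw [expMoment, ← lintegral_const_mul _ (by fun_prop)]
    refine lintegral_congr fun y => ?_
    rw [← ENNReal.ofReal_mul (Real.exp_pos _).le, ← Real.exp_add]
    ring_nf
  rw [hfactor, ENNReal.log_mul_add, ENNReal.log_ofReal_of_pos (Real.exp_pos _), Real.log_exp,
    EReal.neg_add (Or.inl (EReal.coe_ne_bot _)) (Or.inl (EReal.coe_ne_top _)), logMGF,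
    ← EReal.coe_neg, neg_neg]

lemma le_neg_logMGFStar_iff {ν : Measure ℝ} {x : ℝ} {a : EReal} :
    a ≤ -logMGFStar ν x ↔ ∀ γ, a ≤ ENNReal.log (expMoment ν γ x) := by
  simp only [EReal.le_neg, logMGFStar, coe_sub_logMGF, iSup_le_iff, neg_neg,
    EReal.neg_le (b := -a)]

lemma neg_logMGFStar_le_log_expMoment (ν : Measure ℝ) (γ x : ℝ) :
    -logMGFStar ν x ≤ ENNReal.log (expMoment ν γ x) :=
  le_neg_logMGFStar_iff.1 le_rfl γ

lemma isRateFunction_logMGFStar (ν : Measure ℝ) [IsProbabilityMeasure ν] :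
    IsRateFunction (logMGFStar ν) where
  nonneg x := by
    simpa [expMoment] using neg_logMGFStar_le_log_expMoment ν 0 x
  lowerSemicontinuous := by
    refine lowerSemicontinuous_iSup fun γ => Continuous.lowerSemicontinuous ?_
    induction logMGF ν γ with
    | bot => simpa only [EReal.coe_sub_bot] using continuous_const
    | top => simpa only [EReal.sub_top] using continuous_const
    | coe a =>
      have haffine : Continuous fun x : ℝ => ((γ * x - a : ℝ) : EReal) :=
        continuous_coe_real_ereal.comp (by fun_prop)
      simpa only [EReal.coe_sub] using haffine

lemma one_le_expMoment {ν : Measure ℝ} [IsProbabilityMeasure ν]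
    (hν : Integrable (fun y : ℝ => y) ν) {γ x : ℝ} (h : 0 ≤ γ * ((∫ y, y ∂ν) - x)) :
    1 ≤ expMoment ν γ x := by
  have hlin : Integrable (fun y : ℝ => γ * (y - x)) ν :=
    (hν.sub (integrable_const x)).const_mul γ
  have hmean : ∫ y, (γ * (y - x) + 1) ∂ν = γ * ((∫ y, y ∂ν) - x) + 1 := by
    rw [integral_add hlin (integrable_const 1), integral_const_mul,
      integral_sub hν (integrable_const x)]
    simp
  calc (1 : ℝ≥0∞) ≤ ENNReal.ofReal (∫ y, (γ * (y - x) + 1) ∂ν) :=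
        ENNReal.one_le_ofReal.2 (by linarith)
    _ ≤ ∫⁻ y, ENNReal.ofReal (γ * (y - x) + 1) ∂ν := by
        rw [integral_eq_lintegral_pos_part_sub_lintegral_neg_part
          (f := fun y => γ * (y - x) + 1) (hlin.add (integrable_const 1))]
        exact (ENNReal.ofReal_le_ofReal (sub_le_self _ ENNReal.toReal_nonneg)).trans
          ENNReal.ofReal_toReal_le
    _ ≤ expMoment ν γ x :=
        lintegral_mono fun y => ENNReal.ofReal_le_ofReal (Real.add_one_le_exp _)

lemma tendsto_expMoment_natCast_mul {ν : Measure ℝ} [IsFiniteMeasure ν] {x s : ℝ} (hs : s ≠ 0)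
    (h : ∀ᵐ y ∂ν, s * (y - x) ≤ 0) :
    Tendsto (fun n : ℕ => expMoment ν (n * s) x) atTop (𝓝 (ν {x})) := by
  rw [← lintegral_indicator_one (measurableSet_singleton x)]
  refine tendsto_lintegral_of_dominated_convergence (fun _ => 1) (fun n => by fun_prop)
    (fun n => ?_) (by simp) ?_
  · filter_upwards [h] with y hy
    rw [ENNReal.ofReal_le_one, Real.exp_le_one_iff, mul_assoc]
    exact mul_nonpos_of_nonneg_of_nonpos n.cast_nonneg hy
  · filter_upwards [h] with y hy
    rcases eq_or_ne y x with rfl | hyx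
    · simp
    · have hneg : s * (y - x) < 0 := hy.lt_of_ne (mul_ne_zero hs (sub_ne_zero.2 hyx))
      simp_rw [Set.indicator_of_notMem (Set.notMem_singleton_iff.2 hyx), mul_assoc]
      rw [← ENNReal.ofReal_zero]
      exact ENNReal.tendsto_ofReal (Real.tendsto_exp_atBot.comp
        (tendsto_natCast_atTop_atTop.atTop_mul_const_of_neg hneg))

lemma neg_logMGFStar_le_log_singleton {ν : Measure ℝ} [IsFiniteMeasure ν] {x s : ℝ} (hs : s ≠ 0)
    (h : ∀ᵐ y ∂ν, s * (y - x) ≤ 0) : -logMGFStar ν x ≤ ENNReal.log (ν {x}) :=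
  ge_of_tendsto' ((ENNReal.continuous_log.tendsto _).comp (tendsto_expMoment_natCast_mul hs h))
    fun n => neg_logMGFStar_le_log_expMoment ν (n * s) x

lemma logMGFStar_eq_top_of_notMem {ν : Measure ℝ} [IsFiniteMeasure ν] {a b : EReal}
    (hν : ∀ᵐ y ∂ν, y ∈ openInterval a b) {x : ℝ} (hx : x ∉ openInterval a b) :
    logMGFStar ν x = ⊤ := by
  have hx0 : ν {x} = 0 := measure_eq_zero_iff_ae_notMem.2 <|
    hν.mono fun y hy hyx => hx (Set.mem_singleton_iff.1 hyx ▸ hy)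
  have hside : ∃ s : ℝ, s ≠ 0 ∧ ∀ᵐ y ∂ν, s * (y - x) ≤ 0 := by
    by_cases hax : a < (x : EReal)
    · have hbx : b ≤ (x : EReal) := not_lt.1 fun hxb => hx ⟨hax, hxb⟩
      refine ⟨1, one_ne_zero, hν.mono fun y hy => ?_⟩
      linarith [EReal.coe_lt_coe_iff.1 (hy.2.trans_le hbx)]
    · refine ⟨-1, by norm_num, hν.mono fun y hy => ?_⟩
      linarith [EReal.coe_lt_coe_iff.1 ((not_lt.1 hax).trans_lt hy.1)]
  obtain ⟨s, hs, hle⟩ := hside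
  simpa [hx0] using neg_logMGFStar_le_log_singleton hs hle

lemma measure_nonneg_mul_sub_le_expMoment (ν : Measure ℝ) (γ x : ℝ) :
    ν {y | 0 ≤ γ * (y - x)} ≤ expMoment ν γ x := by
  simpa [expMoment] using
    mul_meas_ge_le_lintegral (μ := ν)
      (f := fun y : ℝ => ENNReal.ofReal (Real.exp (γ * (y - x)))) (by fun_prop) 1

/-! ### The law of the sample mean -/

/-- The law of the mean of `n` independent random variables with common law `ν`; it is the Dirac
mass at `0` for `n = 0`. -/
noncomputable def sampleMeanLaw (ν : Measure ℝ) (n : ℕ) : Measure ℝ :=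
  (Measure.pi fun _ : Fin n => ν).map fun v => (∑ i, v i) / n

instance (ν : Measure ℝ) [IsProbabilityMeasure ν] (n : ℕ) :
    IsProbabilityMeasure (sampleMeanLaw ν n) :=
  Measure.isProbabilityMeasure_map (by fun_prop)

lemma hasLaw_sampleMean {Ω : Type*} [MeasurableSpace Ω] {P : Measure Ω} {X : ℕ → Ω → ℝ}
    {ν : Measure ℝ} (hlaw : ∀ i, HasLaw (X i) ν P) (hind : iIndepFun X P) (n : ℕ) :
    HasLaw (sampleMean X n) (sampleMeanLaw ν n) P := by
  have hpi : HasLaw (fun w (i : Fin n) => X i w) (Measure.pi fun _ => ν) P :=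
    (hind.precomp Fin.val_injective).hasLaw_pi fun i => hlaw i
  have havg : HasLaw (fun v : Fin n → ℝ => (∑ i, v i) / n) (sampleMeanLaw ν n)
      (Measure.pi fun _ => ν) := ⟨by fun_prop, rfl⟩
  refine (havg.comp hpi).congr (ae_of_all _ fun w => ?_)
  simp [sampleMean, Finset.sum_range]

lemma lintegral_pi_prod {ι : Type*} [Fintype ι] {E : ι → Type*} [∀ i, MeasurableSpace (E i)]
    (μ : ∀ i, Measure (E i)) [∀ i, IsProbabilityMeasure (μ i)] {f : ∀ i, E i → ℝ≥0∞}
    (hf : ∀ i, Measurable (f i)) :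
    ∫⁻ v, ∏ i, f i (v i) ∂Measure.pi μ = ∏ i, ∫⁻ y, f i y ∂μ i := by
  rw [lintegral_prod_eq_prod_lintegral_of_indepFun _ _
    (iIndepFun_pi fun i => (hf i).aemeasurable) fun i => (hf i).comp (measurable_pi_apply i)]
  exact Finset.prod_congr rfl fun i _ => (measurePreserving_eval μ i).lintegral_comp (hf i)

lemma pi_withDensity {ι : Type*} [Fintype ι] {E : ι → Type*} [∀ i, MeasurableSpace (E i)]
    (μ : ∀ i, Measure (E i)) [∀ i, IsProbabilityMeasure (μ i)] {f : ∀ i, E i → ℝ≥0∞}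
    (hf : ∀ i, Measurable (f i)) [∀ i, SigmaFinite ((μ i).withDensity (f i))] :
    (Measure.pi fun i => (μ i).withDensity (f i)) =
      (Measure.pi μ).withDensity fun v => ∏ i, f i (v i) := by
  refine Measure.pi_eq fun s hs => ?_
  rw [withDensity_apply _ (MeasurableSet.univ_pi hs),
    ← lintegral_indicator (MeasurableSet.univ_pi hs)]
  have hprod : ∀ v : ∀ i, E i, (Set.univ.pi s).indicator (fun v => ∏ i, f i (v i)) v =
      ∏ i, (s i).indicator (f i) (v i) := fun v => by
    by_cases hv : v ∈ Set.univ.pi s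
    · rw [Set.indicator_of_mem hv]
      exact Finset.prod_congr rfl fun i _ =>
        (Set.indicator_of_mem (hv i (Set.mem_univ i)) _).symm
    · obtain ⟨i, hi⟩ : ∃ i, v i ∉ s i := by simpa [Set.mem_univ_pi] using hv
      rw [Set.indicator_of_notMem hv,
        Finset.prod_eq_zero (Finset.mem_univ i) (Set.indicator_of_notMem hi _)]
  simp_rw [hprod]
  rw [lintegral_pi_prod μ fun i => (hf i).indicator (hs i)]
  exact Finset.prod_congr rfl fun i _ => by
    rw [lintegral_indicator (hs i), withDensity_apply _ (hs i)]

lemma natCast_mul_average_sub {n : ℕ} (v : Fin n → ℝ) (x : ℝ) :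
    n * ((∑ i, v i) / n - x) = ∑ i, (v i - x) := by
  rcases eq_or_ne n 0 with rfl | hn
  · simp
  · simp only [Finset.sum_sub_distrib, Finset.sum_const, Finset.card_univ, Fintype.card_fin,
      nsmul_eq_mul]
    field_simp

lemma prod_ofReal_exp_mul_sub {n : ℕ} (γ x : ℝ) (v : Fin n → ℝ) :
    ∏ i, ENNReal.ofReal (Real.exp (γ * (v i - x))) =
      ENNReal.ofReal (Real.exp (n * γ * ((∑ i, v i) / n - x))) := by
  rw [← ENNReal.ofReal_prod_of_nonneg fun i _ => (Real.exp_pos _).le, ← Real.exp_sum,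
    ← Finset.mul_sum, ← natCast_mul_average_sub]
  ring_nf

lemma expMoment_sampleMeanLaw (ν : Measure ℝ) [IsProbabilityMeasure ν] (γ x : ℝ) (n : ℕ) :
    expMoment (sampleMeanLaw ν n) (n * γ) x = expMoment ν γ x ^ n := by
  rw [expMoment, sampleMeanLaw, lintegral_map (by fun_prop) (by fun_prop)]
  simp_rw [← prod_ofReal_exp_mul_sub]
  rw [lintegral_pi_prod (fun _ => ν)
    (f := fun _ y => ENNReal.ofReal (Real.exp (γ * (y - x)))) fun _ => by fun_prop]
  simp [expMoment]

/-! ### The upper bound -/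

lemma sampleMeanLaw_nonneg_mul_sub_le_pow (ν : Measure ℝ) [IsProbabilityMeasure ν] (γ x : ℝ)
    {n : ℕ} (hn : n ≠ 0) :
    sampleMeanLaw ν n {z | 0 ≤ γ * (z - x)} ≤ expMoment ν γ x ^ n := by
  have hn' : (0 : ℝ) < n := by positivity
  have hset : {z : ℝ | 0 ≤ γ * (z - x)} = {z : ℝ | 0 ≤ n * γ * (z - x)} := by
    simp only [mul_assoc, mul_nonneg_iff_of_pos_left hn']
  rw [hset, ← expMoment_sampleMeanLaw]
  exact measure_nonneg_mul_sub_le_expMoment _ _ _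

/-- Both tails at once: `s = 1` is the upper tail, `s = -1` the lower one. Chernoff's bound covers
the `γ` with the sign of `s`; for the others the bound exceeds `1`, by convexity. -/
lemma expGrowthSup_sampleMeanLaw_tail_le {ν : Measure ℝ} [IsProbabilityMeasure ν]
    (hν : Integrable (fun y : ℝ => y) ν) {s x : ℝ} (hs : s ≠ 0) (hx : 0 ≤ s * (x - ∫ y, y ∂ν)) :
    ExpGrowth.expGrowthSup (fun n => sampleMeanLaw ν n {z | 0 ≤ s * (z - x)}) ≤
      -logMGFStar ν x := by
  refine le_neg_logMGFStar_iff.2 fun γ => ?_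
  rw [← ExpGrowth.expGrowthSup_pow]
  refine ExpGrowth.expGrowthSup_eventually_monotone ?_
  filter_upwards [eventually_ne_atTop 0] with n hn
  have hs2 : 0 < s * s := mul_self_pos.2 hs
  rcases le_total 0 (γ * s) with hγ | hγ
  · refine le_trans (measure_mono fun z hz => ?_) (sampleMeanLaw_nonneg_mul_sub_le_pow ν γ x hn)
    have hz' : 0 ≤ s * (z - x) := hz
    refine nonneg_of_mul_nonneg_left (a := γ * (z - x)) (b := s * s) ?_ hs2
    linarith [mul_nonneg hγ hz']
  · refine prob_le_one.trans (one_le_pow₀ (one_le_expMoment hν ?_))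
    refine nonneg_of_mul_nonneg_left (a := γ * ((∫ y, y ∂ν) - x)) (b := s * s) ?_ hs2
    linarith [mul_nonneg (neg_nonneg.2 hγ) hx]

lemma expGrowthSup_sampleMeanLaw_le_of_one_sided {ν : Measure ℝ} [IsProbabilityMeasure ν]
    (hν : Integrable (fun y : ℝ => y) ν) {s : ℝ} (hs : s ≠ 0) {D : Set ℝ} (hD : IsClosed D)
    (hDs : ∀ z ∈ D, 0 ≤ s * (z - ∫ y, y ∂ν)) :
    ExpGrowth.expGrowthSup (fun n => sampleMeanLaw ν n D) ≤ -(⨅ x ∈ D, logMGFStar ν x) := by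
  rcases D.eq_empty_or_nonempty with rfl | hne
  · simp [← Pi.zero_def, ExpGrowth.expGrowthSup_zero]
  set m := ∫ y, y ∂ν
  obtain ⟨x, hxD, hx⟩ := hD.exists_infDist_eq_dist hne m
  have hnearest : ∀ z ∈ D, 0 ≤ s * (z - x) := fun z hz => by
    have hdist : |x - m| ≤ |z - m| := by
      rw [← Real.dist_eq, ← Real.dist_eq, dist_comm x, dist_comm z, ← hx]
      exact Metric.infDist_le_dist_of_mem hz
    have hmul : |s * (x - m)| ≤ |s * (z - m)| := by
      simpa only [abs_mul] using mul_le_mul_of_nonneg_left hdist (abs_nonneg s)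
    rw [abs_of_nonneg (hDs x hxD), abs_of_nonneg (hDs z hz)] at hmul
    linarith
  calc ExpGrowth.expGrowthSup (fun n => sampleMeanLaw ν n D)
      ≤ ExpGrowth.expGrowthSup (fun n => sampleMeanLaw ν n {z | 0 ≤ s * (z - x)}) :=
        ExpGrowth.expGrowthSup_monotone fun n => measure_mono hnearest
    _ ≤ -logMGFStar ν x := expGrowthSup_sampleMeanLaw_tail_le hν hs (hDs x hxD)
    _ ≤ -(⨅ x ∈ D, logMGFStar ν x) := EReal.neg_le_neg_iff.2 (iInf₂_le x hxD)

lemma expGrowthSup_sampleMeanLaw_le {ν : Measure ℝ} [IsProbabilityMeasure ν]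
    (hν : Integrable (fun y : ℝ => y) ν) {C : Set ℝ} (hC : IsClosed C) :
    ExpGrowth.expGrowthSup (fun n => sampleMeanLaw ν n C) ≤ -(⨅ x ∈ C, logMGFStar ν x) := by
  set m := ∫ y, y ∂ν
  have hmono : ∀ D ⊆ C, -(⨅ x ∈ D, logMGFStar ν x) ≤ -(⨅ x ∈ C, logMGFStar ν x) :=
    fun D hD => EReal.neg_le_neg_iff.2 (biInf_mono fun x hx => hD hx)
  have hright : ExpGrowth.expGrowthSup (fun n => sampleMeanLaw ν n (C ∩ Set.Ici m)) ≤
      -(⨅ x ∈ C, logMGFStar ν x) :=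
    (expGrowthSup_sampleMeanLaw_le_of_one_sided hν one_ne_zero (hC.inter isClosed_Ici)
      fun z hz => by linarith [Set.mem_Ici.1 hz.2]).trans (hmono _ Set.inter_subset_left)
  have hleft : ExpGrowth.expGrowthSup (fun n => sampleMeanLaw ν n (C ∩ Set.Iic m)) ≤
      -(⨅ x ∈ C, logMGFStar ν x) :=
    (expGrowthSup_sampleMeanLaw_le_of_one_sided hν (neg_ne_zero.2 one_ne_zero)
      (hC.inter isClosed_Iic) fun z hz => by linarith [Set.mem_Iic.1 hz.2]).trans
      (hmono _ Set.inter_subset_left)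
  refine (ExpGrowth.expGrowthSup_monotone fun n => ?_).trans
    (ExpGrowth.expGrowthSup_add.trans_le (sup_le hright hleft))
  calc sampleMeanLaw ν n C
      = sampleMeanLaw ν n (C ∩ Set.Ici m ∪ C ∩ Set.Iic m) := by
        rw [← Set.inter_union_distrib_left, Set.Ici_union_Iic, Set.inter_univ]
    _ ≤ _ := measure_union_le _ _

/-! ### The lower bound -/

lemma tendsto_sampleMeanLaw_ball {ν : Measure ℝ} [IsProbabilityMeasure ν]
    (hν : Integrable (fun y : ℝ => y) ν) {δ : ℝ} (hδ : 0 < δ) :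
    Tendsto (fun n => sampleMeanLaw ν n (Metric.ball (∫ y, y ∂ν) δ)) atTop (𝓝 1) := by
  obtain ⟨Ω, _, P, X, -, hlaw, hind, _⟩ := exists_iid ℕ ν
  have hmean := hasLaw_sampleMean hlaw hind
  have hslln : ∀ᵐ w ∂P, Tendsto (fun n => sampleMean X n w) atTop (𝓝 (∫ y, y ∂ν)) := by
    rw [← (hlaw 0).integral_eq]
    refine strong_law_ae_real X ?_ (fun i j hij => hind.indepFun hij)
      fun i => (hlaw i).identDistrib (hlaw 0)
    exact ((hlaw 0).identDistrib (HasLaw.id (μ := ν))).integrable_iff.2 hν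
  have hprob : TendstoInMeasure P (sampleMean X) atTop fun _ => ∫ y, y ∂ν :=
    tendstoInMeasure_of_tendsto_ae (fun n => (hmean n).aemeasurable.aestronglyMeasurable) hslln
  have hcompl : ∀ n, sampleMeanLaw ν n (Metric.ball (∫ y, y ∂ν) δ) =
      1 - P {w | δ ≤ dist (sampleMean X n w) (∫ y, y ∂ν)} := fun n => by
    rw [(hmean n).measure_eq (p := fun z => δ ≤ dist z (∫ y, y ∂ν))
      (measurableSet_le (by fun_prop) (by fun_prop)), ← prob_compl_eq_one_sub
      (measurableSet_le (by fun_prop) (by fun_prop))]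
    congr 1
    ext z
    simp
  simp_rw [hcompl]
  simpa using ENNReal.Tendsto.sub tendsto_const_nhds
    (tendstoInMeasure_iff_dist.1 hprob δ hδ) (Or.inl ENNReal.one_ne_top)

lemma sampleMeanLaw_withDensity_ball_le {ν : Measure ℝ} [IsProbabilityMeasure ν] {f : ℝ → ℝ≥0∞}
    (hf : Measurable f) [IsProbabilityMeasure (ν.withDensity f)] {c : ℝ≥0∞} {γ x : ℝ}
    (hfc : ∀ y, f y ≤ c * ENNReal.ofReal (Real.exp (γ * (y - x)))) (η : ℝ) (n : ℕ) :
    sampleMeanLaw (ν.withDensity f) n (Metric.ball x η) ≤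
      (c * ENNReal.ofReal (Real.exp (|γ| * η))) ^ n * sampleMeanLaw ν n (Metric.ball x η) := by
  set A : Set (Fin n → ℝ) := (fun v => (∑ i, v i) / n) ⁻¹' Metric.ball x η
  have hA : MeasurableSet A := (by fun_prop : Measurable fun v : Fin n → ℝ => (∑ i, v i) / n)
    Metric.isOpen_ball.measurableSet
  have hdensity : ∀ v ∈ A, ∏ i, f (v i) ≤ (c * ENNReal.ofReal (Real.exp (|γ| * η))) ^ n :=
    fun v hv => by
      have hdist : |(∑ i, v i) / n - x| ≤ η := (Metric.mem_ball.1 hv).le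
      calc ∏ i, f (v i) ≤ ∏ i, c * ENNReal.ofReal (Real.exp (γ * (v i - x))) :=
            Finset.prod_le_prod' fun i _ => hfc (v i)
        _ = c ^ n * ENNReal.ofReal (Real.exp (n * γ * ((∑ i, v i) / n - x))) := by
            rw [Finset.prod_mul_distrib, prod_ofReal_exp_mul_sub]
            simp
        _ ≤ c ^ n * ENNReal.ofReal (Real.exp (n * (|γ| * η))) := by
            have hexponent : γ * ((∑ i, v i) / n - x) ≤ |γ| * η :=
              (le_abs_self _).trans (by rw [abs_mul]; gcongr)
            rw [mul_assoc]
            gcongr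
        _ = (c * ENNReal.ofReal (Real.exp (|γ| * η))) ^ n := by
            rw [mul_pow, ← ENNReal.ofReal_pow (Real.exp_pos _).le, ← Real.exp_nat_mul]
  rw [sampleMeanLaw, sampleMeanLaw,
    Measure.map_apply (by fun_prop) Metric.isOpen_ball.measurableSet,
    Measure.map_apply (by fun_prop) Metric.isOpen_ball.measurableSet, pi_withDensity _ fun _ => hf,
    withDensity_apply _ hA]
  exact (setLIntegral_mono' hA hdensity).trans_eq (setLIntegral_const _ _)

lemma log_inv_le_expGrowthInf_sampleMeanLaw_ball {ν : Measure ℝ} [IsProbabilityMeasure ν]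
    {f : ℝ → ℝ≥0∞} (hf : Measurable f) [IsProbabilityMeasure (ν.withDensity f)] {c : ℝ≥0∞}
    {γ x : ℝ} (hfc : ∀ y, f y ≤ c * ENNReal.ofReal (Real.exp (γ * (y - x))))
    (hint : Integrable (fun y : ℝ => y) (ν.withDensity f)) (hmean : ∫ y, y ∂ν.withDensity f = x)
    {δ : ℝ} (hδ : 0 < δ) :
    ENNReal.log c⁻¹ ≤ ExpGrowth.expGrowthInf fun n => sampleMeanLaw ν n (Metric.ball x δ) := by
  have hsmall : ∀ η ∈ Set.Ioc 0 δ, ENNReal.log (c * ENNReal.ofReal (Real.exp (|γ| * η)))⁻¹ ≤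
      ExpGrowth.expGrowthInf fun n => sampleMeanLaw ν n (Metric.ball x δ) := fun η hη => by
    rw [← ExpGrowth.expGrowthInf_pow]
    refine ExpGrowth.expGrowthInf_of_eventually_ge (b := 2⁻¹) (by simp) ?_
    filter_upwards [(hmean ▸ tendsto_sampleMeanLaw_ball hint hη.1).eventually_const_le
      ENNReal.one_half_lt_one] with n hn
    rw [← ENNReal.inv_pow, ← div_eq_mul_inv]
    calc 2⁻¹ / (c * ENNReal.ofReal (Real.exp (|γ| * η))) ^ n
        ≤ sampleMeanLaw (ν.withDensity f) n (Metric.ball x η) /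
            (c * ENNReal.ofReal (Real.exp (|γ| * η))) ^ n := by gcongr
      _ ≤ sampleMeanLaw ν n (Metric.ball x η) := ENNReal.div_le_of_le_mul' <|
          sampleMeanLaw_withDensity_ball_le hf hfc η n
      _ ≤ sampleMeanLaw ν n (Metric.ball x δ) := measure_mono (Metric.ball_subset_ball hη.2)
  have hfactor : Tendsto (fun η : ℝ => ENNReal.ofReal (Real.exp (|γ| * η))) (𝓝[>] 0) (𝓝 1) := by
    have hcont : Continuous fun η : ℝ => ENNReal.ofReal (Real.exp (|γ| * η)) :=
      ENNReal.continuous_ofReal.comp (by fun_prop)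
    simpa using (hcont.tendsto 0).mono_left nhdsWithin_le_nhds
  have hlim : Tendsto (fun η : ℝ => ENNReal.log (c * ENNReal.ofReal (Real.exp (|γ| * η)))⁻¹)
      (𝓝[>] 0) (𝓝 (ENNReal.log c⁻¹)) := by
    refine (ENNReal.continuous_log.tendsto _).comp (tendsto_inv_iff.2 ?_)
    simpa using ENNReal.Tendsto.const_mul hfactor (Or.inl one_ne_zero)
  exact le_of_tendsto hlim (mem_of_superset (Ioc_mem_nhdsGT hδ) hsmall)

lemma expMoment_eq_ofReal_mgf {κ : Measure ℝ} {γ x : ℝ}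
    (hγ : γ ∈ integrableExpSet (fun y => y - x) κ) :
    expMoment κ γ x = ENNReal.ofReal (mgf (fun y => y - x) κ γ) :=
  (ofReal_integral_eq_lintegral_ofReal (integrable_of_mem_integrableExpSet hγ)
    (ae_of_all _ fun _ => (Real.exp_pos _).le)).symm

lemma integral_tilted_eq_of_deriv_mgf_eq_zero {κ : Measure ℝ} {γ x : ℝ}
    [IsProbabilityMeasure (κ.tilted fun y => γ * (y - x))]
    (hγ : γ ∈ interior (integrableExpSet (fun y => y - x) κ))
    (hderiv : deriv (mgf (fun y => y - x) κ) γ = 0) :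
    Integrable (fun y : ℝ => y) (κ.tilted fun y => γ * (y - x)) ∧
      ∫ y, y ∂κ.tilted (fun y => γ * (y - x)) = x := by
  have hcentered : Integrable (fun y => y - x) (κ.tilted fun y => γ * (y - x)) :=
    memLp_one_iff_integrable.1 (by exact_mod_cast memLp_tilted_mul hγ 1)
  have hint : Integrable (fun y : ℝ => y) (κ.tilted fun y => γ * (y - x)) :=
    (hcentered.add (integrable_const x)).congr (ae_of_all _ fun y => sub_add_cancel y x)
  have hzero : ∫ y, (y - x) ∂κ.tilted (fun y => γ * (y - x)) = 0 := by
    rw [integral_tilted_mul_self hγ, deriv_cgf hγ, ← deriv_mgf hγ, hderiv, zero_div]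
  rw [integral_sub hint (integrable_const x)] at hzero
  exact ⟨hint, by simpa [sub_eq_zero] using hzero⟩

lemma log_expMoment_restrict_le_expGrowthInf {ν : Measure ℝ} [IsProbabilityMeasure ν] {S : Set ℝ}
    (hS : MeasurableSet S) (hνS : ν S ≠ 0) {γ x : ℝ}
    (hγ : γ ∈ interior (integrableExpSet (fun y => y - x) (ν.restrict S)))
    (hderiv : deriv (mgf (fun y => y - x) (ν.restrict S)) γ = 0) {δ : ℝ} (hδ : 0 < δ) :
    ENNReal.log (expMoment (ν.restrict S) γ x) ≤
      ExpGrowth.expGrowthInf fun n => sampleMeanLaw ν n (Metric.ball x δ) := by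
  have hexp : Integrable (fun y => Real.exp (γ * (y - x))) (ν.restrict S) :=
    integrable_of_mem_integrableExpSet (interior_subset hγ)
  set Z := mgf (fun y => y - x) (ν.restrict S) γ
  have : NeZero (ν.restrict S) := ⟨by simpa using hνS⟩
  have hZ : 0 < Z := mgf_pos' (NeZero.ne _) hexp
  set f : ℝ → ℝ≥0∞ := S.indicator fun y => ENNReal.ofReal (Real.exp (γ * (y - x)) / Z)
  have hf : Measurable f := Measurable.indicator (by fun_prop) hS
  have hρ : ν.withDensity f = (ν.restrict S).tilted fun y => γ * (y - x) :=
    withDensity_indicator hS _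
  have hprob := isProbabilityMeasure_tilted hexp
  obtain ⟨hint, hmean⟩ := integral_tilted_eq_of_deriv_mgf_eq_zero hγ hderiv
  rw [← hρ] at hprob hint hmean
  have hfc : ∀ y, f y ≤ (ENNReal.ofReal Z)⁻¹ * ENNReal.ofReal (Real.exp (γ * (y - x))) := fun y =>
    (Set.indicator_le_self' (fun _ _ => zero_le) y).trans_eq <| by
      rw [ENNReal.ofReal_div_of_pos hZ, ENNReal.div_eq_inv_mul]
  simpa [expMoment_eq_ofReal_mgf (interior_subset hγ)] using
    log_inv_le_expGrowthInf_sampleMeanLaw_ball hf hfc hint hmean hδ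

lemma lowerSemicontinuous_expMoment (κ : Measure ℝ) (x : ℝ) :
    LowerSemicontinuous fun γ => expMoment κ γ x := by
  refine lowerSemicontinuous_iff_le_liminf.2 fun γ => ?_
  have hcont : ∀ y, Continuous fun t : ℝ => ENNReal.ofReal (Real.exp (t * (y - x))) := fun y =>
    ENNReal.continuous_ofReal.comp (by fun_prop)
  calc expMoment κ γ x
      = ∫⁻ y, liminf (fun t => ENNReal.ofReal (Real.exp (t * (y - x)))) (𝓝 γ) ∂κ :=
        lintegral_congr fun y => ((hcont y).tendsto γ).liminf_eq.symm
    _ ≤ liminf (fun t => expMoment κ t x) (𝓝 γ) := lintegral_liminf_le fun t => by fun_prop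

lemma ofReal_mul_lintegral_le_expMoment (κ : Measure ℝ) (s t x : ℝ) :
    ENNReal.ofReal t * ∫⁻ y, ENNReal.ofReal (s * (y - x)) ∂κ ≤ expMoment κ (t * s) x := by
  rcases le_total t 0 with ht | ht
  · simp [ENNReal.ofReal_of_nonpos ht]
  · rw [← lintegral_const_mul _ (by fun_prop)]
    refine lintegral_mono fun y => ?_
    rw [← ENNReal.ofReal_mul ht, mul_assoc]
    exact ENNReal.ofReal_le_ofReal ((lt_add_one _).le.trans (Real.add_one_le_exp _))

lemma le_toReal_of_expMoment_le {κ : Measure ℝ} {s t x : ℝ} {b : ℝ≥0∞} (hb : b ≠ ∞)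
    (hκ : κ {y | 0 < s * (y - x)} ≠ 0) (h : expMoment κ (t * s) x ≤ b) :
    t ≤ (b / ∫⁻ y, ENNReal.ofReal (s * (y - x)) ∂κ).toReal := by
  have hpos : 0 < ∫⁻ y, ENNReal.ofReal (s * (y - x)) ∂κ := by
    rw [lintegral_pos_iff_support (by fun_prop)]
    simpa [Function.support, pos_iff_ne_zero] using hκ
  rw [← ENNReal.ofReal_le_iff_le_toReal (ENNReal.div_ne_top hb hpos.ne')]
  exact ENNReal.le_div_iff_mul_le (Or.inl hpos.ne') (Or.inr hb) |>.2 <|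
    (ofReal_mul_lintegral_le_expMoment κ s t x).trans h

lemma isCompact_setOf_expMoment_le {κ : Measure ℝ} {x : ℝ} (hlt : κ (Set.Iio x) ≠ 0)
    (hgt : κ (Set.Ioi x) ≠ 0) {b : ℝ≥0∞} (hb : b ≠ ∞) : IsCompact {γ | expMoment κ γ x ≤ b} := by
  have hgt' : κ {y | 0 < 1 * (y - x)} ≠ 0 := by simpa [Set.Ioi_def] using hgt
  have hlt' : κ {y | 0 < -1 * (y - x)} ≠ 0 := by simpa [Set.Iio_def] using hlt
  refine isCompact_Icc.of_isClosed_subset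
    ((lowerSemicontinuous_expMoment κ x).isClosed_preimage b) fun γ (hγ : _ ≤ b) =>
    ⟨neg_le.1 (le_toReal_of_expMoment_le hb hlt' ?_),
      le_toReal_of_expMoment_le hb hgt' ?_⟩
  · simpa using hγ
  · simpa using hγ

lemma exists_forall_expMoment_le {κ : Measure ℝ} [IsFiniteMeasure κ] {x : ℝ}
    (hlt : κ (Set.Iio x) ≠ 0) (hgt : κ (Set.Ioi x) ≠ 0) :
    ∃ γ, ∀ t, expMoment κ γ x ≤ expMoment κ t x := by
  have hfinite : expMoment κ 0 x ≠ ∞ := by simp [expMoment]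
  obtain ⟨γ, hγ, hmin⟩ := LowerSemicontinuousOn.exists_isMinOn
    (s := {γ | expMoment κ γ x ≤ expMoment κ 0 x}) ⟨0, le_refl (expMoment κ 0 x)⟩
    (isCompact_setOf_expMoment_le hlt hgt hfinite)
    ((lowerSemicontinuous_expMoment κ x).lowerSemicontinuousOn _)
  refine ⟨γ, fun t => ?_⟩
  rcases le_total (expMoment κ t x) (expMoment κ 0 x) with ht | ht
  · exact hmin ht
  · exact le_trans hγ ht

lemma exists_log_expMoment_restrict_le_expGrowthInf {ν : Measure ℝ} [IsProbabilityMeasure ν]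
    {S : Set ℝ} (hS : IsCompact S) {x : ℝ} (hlt : ν.restrict S (Set.Iio x) ≠ 0)
    (hgt : ν.restrict S (Set.Ioi x) ≠ 0) {δ : ℝ} (hδ : 0 < δ) :
    ∃ γ, ENNReal.log (expMoment (ν.restrict S) γ x) ≤
      ExpGrowth.expGrowthInf fun n => sampleMeanLaw ν n (Metric.ball x δ) := by
  obtain ⟨γ, hγ⟩ := exists_forall_expMoment_le hlt hgt
  have huniv : integrableExpSet (fun y => y - x) (ν.restrict S) = Set.univ :=
    Set.eq_univ_of_forall fun t =>
      (Continuous.continuousOn (by fun_prop)).integrableOn_compact hS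
  have hmin : ∀ t, mgf (fun y => y - x) (ν.restrict S) γ ≤ mgf (fun y => y - x) (ν.restrict S) t :=
    fun t => by
      have h := hγ t
      rwa [expMoment_eq_ofReal_mgf (huniv ▸ Set.mem_univ _),
        expMoment_eq_ofReal_mgf (huniv ▸ Set.mem_univ _),
        ENNReal.ofReal_le_ofReal_iff mgf_nonneg] at h
  have hνS : ν S ≠ 0 := fun h => hlt (by simp [Measure.restrict_eq_zero.2 h])
  exact ⟨γ, log_expMoment_restrict_le_expGrowthInf hS.measurableSet hνS (by simp [huniv])
    (IsLocalMin.deriv_eq_zero (Eventually.of_forall hmin)) hδ⟩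

lemma eventually_restrict_closedBall_ne_zero {ν : Measure ℝ} (x : ℝ) {A : Set ℝ} (hA : ν A ≠ 0) :
    ∀ᶠ k : ℕ in atTop, ν.restrict (Metric.closedBall x k) A ≠ 0 := by
  have hmono : Monotone fun k : ℕ => A ∩ Metric.closedBall x k := fun k l hkl =>
    Set.inter_subset_inter_right _ (Metric.closedBall_subset_closedBall (by exact_mod_cast hkl))
  have hlim := tendsto_measure_iUnion_atTop (μ := ν) hmono
  rw [← Set.inter_iUnion, Metric.iUnion_closedBall_nat, Set.inter_univ] at hlim
  filter_upwards [hlim.eventually_ne hA] with k hk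
  rwa [Measure.restrict_apply' Metric.isClosed_closedBall.measurableSet]

lemma iSup_expMoment_restrict {ν : Measure ℝ} {S : ℕ → Set ℝ} (hS : Monotone S)
    (hunion : ⋃ k, S k = Set.univ) (γ x : ℝ) :
    ⨆ k, expMoment (ν.restrict (S k)) γ x = expMoment ν γ x := by
  simp only [expMoment]
  rw [← setLIntegral_iUnion_of_directed _ hS.directed_le, hunion, Measure.restrict_univ]

/-- The minimizers of the exponential moments of the truncations of `ν` need not converge to a
minimizer for `ν`, but they lie in nested compact level sets, and any common point `γ` of these
satisfies `log (expMoment ν γ x) ≤ a`. -/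
lemma neg_logMGFStar_le_of_restrict {ν : Measure ℝ} {x : ℝ} {S : ℕ → Set ℝ} (hS : Monotone S)
    (hunion : ⋃ k, S k = Set.univ) (hlt : ν.restrict (S 0) (Set.Iio x) ≠ 0)
    (hgt : ν.restrict (S 0) (Set.Ioi x) ≠ 0) {a : EReal} (ha : a ≠ ⊤)
    (hle : ∀ k, ∃ γ, ENNReal.log (expMoment (ν.restrict (S k)) γ x) ≤ a) :
    -logMGFStar ν x ≤ a := by
  let K : ℕ → Set ℝ := fun k => {γ | expMoment (ν.restrict (S k)) γ x ≤ a.exp}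
  have hmem : ∀ {k γ}, γ ∈ K k ↔ ENNReal.log (expMoment (ν.restrict (S k)) γ x) ≤ a := by
    simp [K, ← ENNReal.log_le_log_iff]
  have hclosed : ∀ k, IsClosed (K k) := fun k =>
    (lowerSemicontinuous_expMoment _ x).isClosed_preimage _
  have hcompact : IsCompact (K 0) :=
    isCompact_setOf_expMoment_le hlt hgt (EReal.exp_eq_top_iff.not.2 ha)
  have hanti : ∀ k, K (k + 1) ⊆ K k := fun k γ hγ =>
    (lintegral_mono' (Measure.restrict_mono (hS k.le_succ) le_rfl) le_rfl).trans hγ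
  obtain ⟨γ, hγ⟩ := IsCompact.nonempty_iInter_of_sequence_nonempty_isCompact_isClosed K hanti
    (fun k => (hle k).imp fun _ => hmem.2) hcompact hclosed
  have hexp : expMoment ν γ x ≤ a.exp :=
    iSup_expMoment_restrict hS hunion γ x ▸ iSup_le fun k => Set.mem_iInter.1 hγ k
  calc -logMGFStar ν x ≤ ENNReal.log (expMoment ν γ x) := neg_logMGFStar_le_log_expMoment ν γ x
    _ ≤ a := by rwa [← ENNReal.log_le_log_iff, EReal.log_exp] at hexp

lemma pow_measure_singleton_le_sampleMeanLaw (ν : Measure ℝ) [IsProbabilityMeasure ν] (x : ℝ)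
    {n : ℕ} (hn : n ≠ 0) : ν {x} ^ n ≤ sampleMeanLaw ν n {x} := by
  have hconst : {fun _ => x} ⊆ (fun v : Fin n → ℝ => (∑ i, v i) / n) ⁻¹' {x} := by
    simp [hn]
  calc ν {x} ^ n = Measure.pi (fun _ : Fin n => ν) {fun _ => x} := by simp
    _ ≤ sampleMeanLaw ν n {x} := by
      rw [sampleMeanLaw, Measure.map_apply (by fun_prop) (measurableSet_singleton x)]
      exact measure_mono hconst

lemma log_measure_singleton_le_expGrowthInf (ν : Measure ℝ) [IsProbabilityMeasure ν] {x : ℝ}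
    {U : Set ℝ} (hx : x ∈ U) :
    ENNReal.log (ν {x}) ≤ ExpGrowth.expGrowthInf fun n => sampleMeanLaw ν n U := by
  rw [← ExpGrowth.expGrowthInf_pow]
  refine ExpGrowth.expGrowthInf_eventually_monotone ?_
  filter_upwards [eventually_ne_atTop 0] with n hn
  exact (pow_measure_singleton_le_sampleMeanLaw ν x hn).trans
    (measure_mono (Set.singleton_subset_iff.2 hx))

lemma neg_logMGFStar_le_expGrowthInf_ball (ν : Measure ℝ) [IsProbabilityMeasure ν] (x : ℝ) {δ : ℝ}
    (hδ : 0 < δ) :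
    -logMGFStar ν x ≤ ExpGrowth.expGrowthInf fun n => sampleMeanLaw ν n (Metric.ball x δ) := by
  have hatom := log_measure_singleton_le_expGrowthInf ν (Metric.mem_ball_self (x := x) hδ)
  by_cases hgt : ν (Set.Ioi x) = 0
  · refine (neg_logMGFStar_le_log_singleton one_ne_zero ?_).trans hatom
    filter_upwards [measure_eq_zero_iff_ae_notMem.1 hgt] with y hy
    linarith [Set.notMem_Ioi.1 hy]
  by_cases hlt : ν (Set.Iio x) = 0
  · refine (neg_logMGFStar_le_log_singleton (neg_ne_zero.2 one_ne_zero) ?_).trans hatom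
    filter_upwards [measure_eq_zero_iff_ae_notMem.1 hlt] with y hy
    linarith [Set.notMem_Iio.1 hy]
  obtain ⟨N, hN⟩ := eventually_atTop.1 ((eventually_restrict_closedBall_ne_zero x hlt).and
    (eventually_restrict_closedBall_ne_zero x hgt))
  have hballs : Monotone fun k : ℕ => Metric.closedBall x (k : ℝ) := fun k l hkl =>
    Metric.closedBall_subset_closedBall (by exact_mod_cast hkl)
  have hgrowth : ExpGrowth.expGrowthInf (fun n => sampleMeanLaw ν n (Metric.ball x δ)) ≠ ⊤ :=
    ((ExpGrowth.expGrowthInf_monotone fun n => prob_le_one).trans_lt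
      (by simp [ExpGrowth.expGrowthInf_const])).ne
  exact neg_logMGFStar_le_of_restrict (S := fun k => Metric.closedBall x ((k + N : ℕ) : ℝ))
    (fun k l hkl => hballs (Nat.add_le_add_right hkl N))
    ((hballs.iUnion_nat_add N).trans (Metric.iUnion_closedBall_nat x))
    (hN _ le_add_self).1 (hN _ le_add_self).2 hgrowth fun k =>
    exists_log_expMoment_restrict_le_expGrowthInf (isCompact_closedBall _ _)
      (hN _ le_add_self).1 (hN _ le_add_self).2 hδ

/-! ### Cramér's theorem -/

theorem satisfiesLDP_sampleMean {Ω : Type*} [MeasurableSpace Ω] {P : Measure Ω} {X : ℕ → Ω → ℝ}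
    {ν : Measure ℝ} [IsProbabilityMeasure ν] (hlaw : ∀ i, HasLaw (X i) ν P) (hind : iIndepFun X P)
    (hν : Integrable (fun y : ℝ => y) ν) : SatisfiesLDP P (sampleMean X) (logMGFStar ν) where
  aemeasurable n _ := (hasLaw_sampleMean hlaw hind n).aemeasurable
  isRateFunction := isRateFunction_logMGFStar ν
  lower_bound O hO := by
    have hlawO n := (hasLaw_sampleMean hlaw hind n).measure_eq (p := (· ∈ O)) hO.measurableSet
    simp_rw [hlawO]
    rw [EReal.neg_le]
    refine le_iInf₂ fun x hx => EReal.neg_le.1 ?_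
    obtain ⟨δ, hδ, hball⟩ := Metric.isOpen_iff.1 hO x hx
    exact (neg_logMGFStar_le_expGrowthInf_ball ν x hδ).trans
      (ExpGrowth.expGrowthInf_monotone fun n => measure_mono hball)
  upper_bound C hC := by
    have hlawC n := (hasLaw_sampleMean hlaw hind n).measure_eq (p := (· ∈ C)) hC.measurableSet
    simp_rw [hlawC]
    exact expGrowthSup_sampleMeanLaw_le hν hC

/-! ### The contraction principle -/

section Contraction

variable {𝒳 𝒲 : Type*} {I : 𝒳 → EReal} {g : 𝒳 → 𝒲} {S : Set 𝒳}

/-- The rate function that the contraction principle attaches to the image under `g` of random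
variables with rate function `I`. -/
noncomputable def contractedRate (I : 𝒳 → EReal) (g : 𝒳 → 𝒲) (w : 𝒲) : EReal :=
  ⨅ (x) (_ : g x = w), I x

lemma contractedRate_apply_le (I : 𝒳 → EReal) (g : 𝒳 → 𝒲) (x : 𝒳) :
    contractedRate I g (g x) ≤ I x :=
  iInf₂_le (f := fun y (_ : g y = g x) => I y) x rfl

lemma iInf_contractedRate (I : 𝒳 → EReal) (g : 𝒳 → 𝒲) (A : Set 𝒲) :
    ⨅ w ∈ A, contractedRate I g w = ⨅ x ∈ g ⁻¹' A, I x :=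
  le_antisymm
    (le_iInf₂ fun x hx => (iInf₂_le (g x) hx).trans (contractedRate_apply_le I g x))
    (le_iInf₂ fun _ hw => le_iInf₂ fun x hx => iInf₂_le x (hx ▸ hw : g x ∈ A))

lemma contractedRate_comp {𝒱 : Type*} (I : 𝒳 → EReal) (g : 𝒳 → 𝒲) (f : 𝒲 → 𝒱) :
    contractedRate I (f ∘ g) = contractedRate (contractedRate I g) f :=
  funext fun v => (iInf_contractedRate I g {w | f w = v}).symm

lemma contractedRate_eq_comp {h : 𝒲 → 𝒳} (hI : ∀ x ∉ S, I x = ⊤)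
    (hgh : ∀ w, h w ∈ S → g (h w) = w) (hhg : ∀ x ∈ S, h (g x) = x) :
    contractedRate I g = I ∘ h := by
  refine funext fun w => le_antisymm ?_ (le_iInf₂ fun x hx => ?_)
  · by_cases hw : h w ∈ S
    · exact iInf₂_le (h w) (hgh w hw)
    · simp [hI _ hw]
  · by_cases hxS : x ∈ S
    · rw [← hx, Function.comp_apply, hhg x hxS]
    · simp [hI x hxS]

lemma contractedRate_eq_comp_of_affine {I : ℝ → EReal} {S : Set ℝ} (hI : ∀ x ∉ S, I x = ⊤)
    {g : ℝ → ℝ} {c₁ c₀ : ℝ} (hc₁ : c₁ ≠ 0) (hg : ∀ m ∈ S, g m = c₁ * m + c₀) :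
    contractedRate I g = I ∘ fun t => (t - c₀) / c₁ := by
  refine contractedRate_eq_comp hI (fun t ht => ?_) fun m hm => ?_
  · rw [hg _ ht]
    field_simp
    ring
  · rw [hg m hm]
    field_simp
    ring

lemma setOf_le_subset (hI : ∀ x ∉ S, I x = ⊤) (η : ℝ) : {x | I x ≤ η} ⊆ S := fun x hx => by
  by_contra hxS
  exact EReal.coe_ne_top η (top_le_iff.1 (hI x hxS ▸ hx))

variable [TopologicalSpace 𝒳] [TopologicalSpace 𝒲]

lemma IsRateFunction.comp {I : 𝒲 → EReal} (hI : IsRateFunction I) (hg : Continuous g) :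
    IsRateFunction (I ∘ g) :=
  ⟨fun x => hI.nonneg (g x), hI.lowerSemicontinuous.comp hg⟩

lemma closure_inter_preimage_inter_subset (hg : ContinuousOn g S) {C : Set 𝒲} (hC : IsClosed C) :
    closure (S ∩ g ⁻¹' C) ∩ S ⊆ g ⁻¹' C := fun x ⟨hx, hxS⟩ => by
  have hne : (𝓝[S ∩ g ⁻¹' C] x).NeBot := mem_closure_iff_nhdsWithin_neBot.1 hx
  have hlim : Tendsto g (𝓝[S ∩ g ⁻¹' C] x) (𝓝 (g x)) :=
    (hg x hxS).mono_left (nhdsWithin_mono x Set.inter_subset_left)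
  exact hC.mem_of_tendsto hlim (eventually_nhdsWithin_of_forall fun _ hy => hy.2)

theorem SatisfiesLDP.contraction {Ω : Type*} [MeasurableSpace Ω] {P : Measure Ω}
    [MeasurableSpace 𝒳] [OpensMeasurableSpace 𝒳] [MeasurableSpace 𝒲] [BorelSpace 𝒲]
    {W : ℕ → Ω → 𝒳} (hW : SatisfiesLDP P W I) (hS : IsOpen S) (hI : ∀ x ∉ S, I x = ⊤)
    (hWS : ∀ n, 1 ≤ n → ∀ᵐ w ∂P, W n w ∈ S) (hg : ContinuousOn g S)
    (hrate : IsRateFunction (contractedRate I g)) :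
    SatisfiesLDP P (fun n w => g (W n w)) (contractedRate I g) where
  aemeasurable n hn := by
    have hmap : ∀ᵐ x ∂P.map (W n), x ∈ S :=
      (ae_map_iff (hW.aemeasurable n hn) hS.measurableSet).2 (hWS n hn)
    refine AEMeasurable.comp_aemeasurable ?_ (hW.aemeasurable n hn)
    rw [← Measure.restrict_eq_self_of_ae_mem hmap]
    exact hg.aemeasurable hS.measurableSet
  isRateFunction := hrate
  lower_bound O hO := by
    have hinf : ⨅ x ∈ S ∩ g ⁻¹' O, I x ≤ ⨅ w ∈ O, contractedRate I g w := by
      rw [iInf_contractedRate]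
      refine le_iInf₂ fun x hx => ?_
      by_cases hxS : x ∈ S
      · exact iInf₂_le x ⟨hxS, hx⟩
      · simp [hI x hxS]
    exact (EReal.neg_le_neg_iff.2 hinf).trans <|
      (hW.lower_bound _ (hg.isOpen_inter_preimage hS hO)).trans <|
        ExpGrowth.expGrowthInf_monotone fun n => measure_mono fun _ h => h.2
  upper_bound C hC := by
    have hinf : ⨅ w ∈ C, contractedRate I g w ≤ ⨅ x ∈ closure (S ∩ g ⁻¹' C), I x := by
      rw [iInf_contractedRate]
      refine le_iInf₂ fun x hx => ?_
      by_cases hxS : x ∈ S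
      · exact iInf₂_le x (closure_inter_preimage_inter_subset hg hC ⟨hx, hxS⟩)
      · simp [hI x hxS]
    have hprob : ∀ᶠ n in atTop, P {w | g (W n w) ∈ C} ≤ P {w | W n w ∈ closure (S ∩ g ⁻¹' C)} := by
      filter_upwards [eventually_ge_atTop 1] with n hn
      refine measure_mono_ae ?_
      filter_upwards [hWS n hn] with w hwS hwC using subset_closure ⟨hwS, hwC⟩
    exact (ExpGrowth.expGrowthSup_eventually_monotone hprob).trans <|
      (hW.upper_bound _ isClosed_closure).trans (EReal.neg_le_neg_iff.2 hinf)

lemma isGoodRateFunction_of_isCompact_le [T2Space 𝒲] {J : 𝒲 → EReal} (hnonneg : ∀ w, 0 ≤ J w)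
    (hcompact : ∀ η : ℝ, IsCompact {w | J w ≤ η}) : IsGoodRateFunction J where
  nonneg := hnonneg
  isCompact_le η _ := hcompact η
  lowerSemicontinuous := lowerSemicontinuous_iff_isClosed_preimage.2 fun c => by
    induction c with
    | bot =>
      have hempty : J ⁻¹' Set.Iic ⊥ = ∅ := Set.eq_empty_of_forall_notMem fun w hw =>
        (EReal.bot_lt_zero.trans_le (hnonneg w)).not_ge hw
      exact hempty ▸ isClosed_empty
    | top => simp
    | coe η => exact (hcompact η).isClosed

lemma IsGoodRateFunction.isCompact_setOf_le (hI : IsGoodRateFunction I) (η : ℝ) :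
    IsCompact {x | I x ≤ η} := by
  rcases le_or_gt 0 η with hη | hη
  · exact hI.isCompact_le η hη
  · have hempty : {x | I x ≤ η} = ∅ := Set.eq_empty_of_forall_notMem fun x hx =>
      ((EReal.coe_neg'.2 hη).trans_le (hI.nonneg x)).not_ge hx
    exact hempty ▸ isCompact_empty

lemma IsGoodRateFunction.exists_le_of_contractedRate_le [T1Space 𝒲] (hI : IsGoodRateFunction I)
    (htop : ∀ x ∉ S, I x = ⊤) (hg : ContinuousOn g S) {w : 𝒲} {η : ℝ}
    (hw : contractedRate I g w ≤ η) : ∃ x, g x = w ∧ I x ≤ η := by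
  obtain ⟨u, hu, hfiber⟩ :=
    continuousOn_iff_isClosed.1 (hg.mono (setOf_le_subset htop (η + 1))) {w} isClosed_singleton
  have hcompact : IsCompact (g ⁻¹' {w} ∩ {x | I x ≤ (η + 1 : ℝ)}) :=
    hfiber ▸ (hI.isCompact_setOf_le (η + 1)).inter_left hu
  have hlt : contractedRate I g w < (η + 1 : ℝ) :=
    hw.trans_lt (EReal.coe_lt_coe_iff.2 (lt_add_one η))
  simp only [contractedRate, iInf_lt_iff] at hlt
  obtain ⟨y, hyw, hy⟩ := hlt
  obtain ⟨x, ⟨hxw, hx⟩, hmin⟩ :=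
    (hI.lowerSemicontinuous.lowerSemicontinuousOn _).exists_isMinOn
      (s := g ⁻¹' {w} ∩ {x | I x ≤ (η + 1 : ℝ)}) ⟨y, hyw, hy.le⟩ hcompact
  refine ⟨x, hxw, le_trans (le_iInf₂ fun z hz => ?_) hw⟩
  rcases le_total (I z) (η + 1 : ℝ) with hzη | hzη
  · exact hmin ⟨hz, hzη⟩
  · exact le_trans hx hzη

theorem IsGoodRateFunction.contraction [T2Space 𝒲] (hI : IsGoodRateFunction I)
    (htop : ∀ x ∉ S, I x = ⊤) (hg : ContinuousOn g S) :
    IsGoodRateFunction (contractedRate I g) := by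
  refine isGoodRateFunction_of_isCompact_le (fun w => le_iInf₂ fun x _ => hI.nonneg x) fun η => ?_
  have himage : {w | contractedRate I g w ≤ η} = g '' {x | I x ≤ η} := by
    refine Set.Subset.antisymm (fun w hw => ?_) ?_
    · obtain ⟨x, hxw, hx⟩ := hI.exists_le_of_contractedRate_le htop hg hw
      exact ⟨x, hx, hxw⟩
    · rintro _ ⟨x, hx, rfl⟩
      exact (contractedRate_apply_le I g x).trans hx
  exact himage ▸ (hI.isCompact_setOf_le η).image_of_continuousOn (hg.mono (setOf_le_subset htop η))

end Contraction

/-! ### Moment-matching estimators -/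

lemma isOpen_openInterval (a b : EReal) : IsOpen (openInterval a b) :=
  (isOpen_lt continuous_const continuous_coe_real_ereal).inter
    (isOpen_lt continuous_coe_real_ereal continuous_const)

lemma convex_openInterval (a b : EReal) : Convex ℝ (openInterval a b) :=
  Set.OrdConnected.convex ⟨fun _ hx _ hy _ hz =>
    ⟨hx.1.trans_le (EReal.coe_le_coe_iff.2 hz.1), (EReal.coe_le_coe_iff.2 hz.2).trans_lt hy.2⟩⟩

section Sample

variable {Ω : Type*} [MeasurableSpace Ω] {P : Measure Ω} {X : ℕ → Ω → ℝ} {ν : Measure ℝ} {S : Set ℝ}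

lemma ae_sampleMean_mem (hlaw : ∀ i, HasLaw (X i) ν P) (hS : Convex ℝ S)
    (hν : ∀ᵐ y ∂ν, y ∈ S) {n : ℕ} (hn : 1 ≤ n) : ∀ᵐ w ∂P, sampleMean X n w ∈ S := by
  have hall : ∀ᵐ w ∂P, ∀ i, X i w ∈ S := ae_all_iff.2 fun i =>
    ae_of_ae_map (hlaw i).aemeasurable ((hlaw i).map_eq ▸ hν)
  filter_upwards [hall] with w hw
  have hn' : n ≠ 0 := Nat.one_le_iff_ne_zero.1 hn
  have hsum := hS.sum_mem (t := Finset.range n) (w := fun _ => (n : ℝ)⁻¹) (z := fun i => X i w)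
    (fun _ _ => by positivity) (by simp [hn']) fun i _ => hw i
  rwa [← Finset.smul_sum, smul_eq_mul, inv_mul_eq_div] at hsum

lemma satisfiesLDP_comp_sampleMean [IsProbabilityMeasure ν] {𝒲 : Type*} [TopologicalSpace 𝒲]
    [MeasurableSpace 𝒲] [BorelSpace 𝒲] {g : ℝ → 𝒲} {a b : EReal}
    (hlaw : ∀ i, HasLaw (X i) ν P) (hind : iIndepFun X P) (hint : Integrable (fun y : ℝ => y) ν)
    (hν : ∀ᵐ y ∂ν, y ∈ openInterval a b) (hg : ContinuousOn g (openInterval a b))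
    (hrate : IsRateFunction (contractedRate (logMGFStar ν) g)) :
    SatisfiesLDP P (fun n w => g (sampleMean X n w)) (contractedRate (logMGFStar ν) g) :=
  (satisfiesLDP_sampleMean hlaw hind hint).contraction (isOpen_openInterval a b)
    (fun _ => logMGFStar_eq_top_of_notMem hν)
    (fun _ => ae_sampleMean_mem hlaw (convex_openInterval a b) hν) hg hrate

end Sample

section Estimator

variable {Θ : Set ℝ} {F : Θ → Measure ℝ} {α ω : Θ → EReal} {θ₀ : Θ}

lemma openInterval_subset_meanSpace (θ₀ : Θ) : openInterval (α θ₀) (ω θ₀) ⊆ meanSpace α ω :=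
  Set.subset_iUnion (fun θ => openInterval (α θ) (ω θ)) θ₀

lemma mmRateReal_comp_val : mmRateReal F α ω θ₀ ∘ Subtype.val = mmRate F α ω θ₀ :=
  funext fun θ => by simp [mmRateReal]

lemma mmRateReal_eq_contractedRate :
    mmRateReal F α ω θ₀ = contractedRate (mmRate F α ω θ₀) Subtype.val := by
  refine funext fun t => ?_
  by_cases ht : t ∈ Θ
  · lift t to Θ using ht
    simp [mmRateReal, contractedRate, Subtype.val_inj]
  · have hne : ∀ θ : Θ, (θ : ℝ) ≠ t := fun θ h => ht (h ▸ θ.2)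
    simp [mmRateReal, contractedRate, ht, hne]

lemma mmRate_eq_comp_mean
    (htop : ∀ x ∉ openInterval (α θ₀) (ω θ₀), logMGFStar (F θ₀) x = ⊤) :
    mmRate F α ω θ₀ = logMGFStar (F θ₀) ∘ mean F :=
  funext fun θ => by
    by_cases hθ : mean F θ ∈ openInterval (α θ₀) (ω θ₀)
    · simp [mmRate, hθ]
    · simp [mmRate, hθ, htop]

variable [Nonempty Θ]

lemma mmRate_eq_contractedRate
    (htop : ∀ x ∉ openInterval (α θ₀) (ω θ₀), logMGFStar (F θ₀) x = ⊤)
    (hmean : ∀ m ∈ openInterval (α θ₀) (ω θ₀), ∃! θ, mean F θ = m) :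
    mmRate F α ω θ₀ = contractedRate (logMGFStar (F θ₀)) (meanInv F) := by
  have hright : ∀ m ∈ openInterval (α θ₀) (ω θ₀), mean F (meanInv F m) = m :=
    fun m hm => Function.invFun_eq (hmean m hm).exists
  rw [mmRate_eq_comp_mean htop]
  exact (contractedRate_eq_comp htop
    (fun θ hθ => (hmean _ hθ).unique (hright _ hθ) rfl) hright).symm

lemma mmRateReal_eq_contractedRate_meanInv
    (htop : ∀ x ∉ openInterval (α θ₀) (ω θ₀), logMGFStar (F θ₀) x = ⊤)
    (hmean : ∀ m ∈ openInterval (α θ₀) (ω θ₀), ∃! θ, mean F θ = m) :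
    mmRateReal F α ω θ₀ = contractedRate (logMGFStar (F θ₀)) (fun m => (meanInv F m : ℝ)) := by
  rw [mmRateReal_eq_contractedRate, mmRate_eq_contractedRate htop hmean, ← contractedRate_comp]
  rfl

end Estimator

end MMEst

theorem proposition4p1_general {Θ : Set ℝ} [Nonempty Θ] {F : Θ → Measure ℝ} {α ω : Θ → EReal}
    {θ₀ : Θ} {Ω : Type*} [MeasurableSpace Ω] {P : Measure Ω} {X : ℕ → Ω → ℝ}
    [IsProbabilityMeasure (F θ₀)] (hlaw : ∀ i, HasLaw (X i) (F θ₀) P) (hind : iIndepFun X P)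
    (hF : F θ₀ (openInterval (α θ₀) (ω θ₀)) = 1) (hint : ∀ θ, Integrable (fun x : ℝ => x) (F θ))
    (hmean : ∀ m ∈ openInterval (α θ₀) (ω θ₀), ∃! θ, mean F θ = m) :
    ((∃ c₁ c₀ : ℝ, c₁ ≠ 0 ∧
        ∀ m ∈ openInterval (α θ₀) (ω θ₀), (meanInv F m : ℝ) = c₁ * m + c₀) →
      SatisfiesLDP P (mmEstimator F X) (mmRate F α ω θ₀) ∧
      SatisfiesLDP P (fun n x => (mmEstimator F X n x : ℝ)) (mmRateReal F α ω θ₀)) ∧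
    (ContinuousOn (meanInv F) (openInterval (α θ₀) (ω θ₀)) →
      IsGoodRateFunction (logMGFStar (F θ₀)) →
      (SatisfiesLDP P (mmEstimator F X) (mmRate F α ω θ₀) ∧
        IsGoodRateFunction (mmRate F α ω θ₀)) ∧
      (SatisfiesLDP P (fun n x => (mmEstimator F X n x : ℝ)) (mmRateReal F α ω θ₀) ∧
        IsGoodRateFunction (mmRateReal F α ω θ₀))) := by
  have hae : ∀ᵐ y ∂F θ₀, y ∈ openInterval (α θ₀) (ω θ₀) :=
    (mem_ae_iff_prob_eq_one (isOpen_openInterval _ _).measurableSet).2 hF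
  have htop : ∀ x ∉ openInterval (α θ₀) (ω θ₀), logMGFStar (F θ₀) x = ⊤ :=
    fun _ => logMGFStar_eq_top_of_notMem hae
  have hJ := mmRate_eq_contractedRate htop hmean
  have hJReal := mmRateReal_eq_contractedRate_meanInv htop hmean
  have hLDP (hcont : ContinuousOn (meanInv F) (openInterval (α θ₀) (ω θ₀)))
      (hrate : IsRateFunction (mmRate F α ω θ₀)) :
      SatisfiesLDP P (mmEstimator F X) (mmRate F α ω θ₀) :=
    hJ ▸ satisfiesLDP_comp_sampleMean hlaw hind (hint θ₀) hae hcont (hJ ▸ hrate)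
  have hLDPReal (hcont : ContinuousOn (fun m => (meanInv F m : ℝ)) (openInterval (α θ₀) (ω θ₀)))
      (hrate : IsRateFunction (mmRateReal F α ω θ₀)) :
      SatisfiesLDP P (fun n x => (mmEstimator F X n x : ℝ)) (mmRateReal F α ω θ₀) :=
    hJReal ▸ satisfiesLDP_comp_sampleMean hlaw hind (hint θ₀) hae hcont (hJReal ▸ hrate)
  refine ⟨fun ⟨c₁, c₀, hc₁, haff⟩ => ?_, fun hcont hgood => ?_⟩
  · have hcontReal : ContinuousOn (fun m => (meanInv F m : ℝ)) (openInterval (α θ₀) (ω θ₀)) :=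
      ContinuousOn.congr (f := fun m => c₁ * m + c₀) (by fun_prop) haff
    have hrateReal : IsRateFunction (mmRateReal F α ω θ₀) := by
      rw [hJReal, contractedRate_eq_comp_of_affine htop hc₁ haff]
      exact (isRateFunction_logMGFStar (F θ₀)).comp (by fun_prop)
    have hrate : IsRateFunction (mmRate F α ω θ₀) :=
      mmRateReal_comp_val ▸ hrateReal.comp continuous_subtype_val
    exact ⟨hLDP (Topology.IsInducing.subtypeVal.continuousOn_iff.2 hcontReal) hrate,
      hLDPReal hcontReal hrateReal⟩
  · have hcontReal := continuous_subtype_val.comp_continuousOn hcont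
    have hgoodJ : IsGoodRateFunction (mmRate F α ω θ₀) := hJ ▸ hgood.contraction htop hcont
    have hgoodJReal : IsGoodRateFunction (mmRateReal F α ω θ₀) :=
      hJReal ▸ hgood.contraction htop hcontReal
    exact ⟨⟨hLDP hcont hgoodJ.toIsRateFunction, hgoodJ⟩,
      hLDPReal hcontReal hgoodJReal.toIsRateFunction, hgoodJReal⟩

theorem proposition4p1 {Θ : Set ℝ} [Nonempty Θ] (F : Θ → Measure ℝ) (α ω : Θ → EReal)
    (hF : MMCondition F α ω) (θ₀ : Θ)
    {Ω : Type*} [MeasurableSpace Ω] (P : Measure Ω) [IsProbabilityMeasure P]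
    (X : ℕ → Ω → ℝ) (hX_meas : ∀ i, Measurable (X i)) (hX_indep : iIndepFun X P)
    (hX_law : ∀ i, P.map (X i) = F θ₀) :
    -- (i) affine inverse: LDP on `Θ` and on `ℝ`
    ((∃ c₁ c₀ : ℝ, c₁ ≠ 0 ∧ ∀ m ∈ meanSpace α ω, (meanInv F m : ℝ) = c₁ * m + c₀) →
      SatisfiesLDP P (mmEstimator F X) (mmRate F α ω θ₀) ∧
      SatisfiesLDP P (fun n x => (mmEstimator F X n x : ℝ)) (mmRateReal F α ω θ₀)) ∧
    -- (ii) continuous inverse, good `Λ*`: the same LDP, with a good rate function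
    (ContinuousOn (meanInv F) (openInterval (α θ₀) (ω θ₀)) →
      IsGoodRateFunction (logMGFStar (F θ₀)) →
      (SatisfiesLDP P (mmEstimator F X) (mmRate F α ω θ₀) ∧
        IsGoodRateFunction (mmRate F α ω θ₀)) ∧
      (SatisfiesLDP P (fun n x => (mmEstimator F X n x : ℝ)) (mmRateReal F α ω θ₀) ∧
        IsGoodRateFunction (mmRateReal F α ω θ₀))) := by
  have := hF.isProbabilityMeasure θ₀
  have hsub : openInterval (α θ₀) (ω θ₀) ⊆ meanSpace α ω := openInterval_subset_meanSpace θ₀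
  exact (proposition4p1_general (fun i => ⟨(hX_meas i).aemeasurable, hX_law i⟩) hX_indep
    (hF.concentrated θ₀) hF.integrable fun m hm => hF.existsUnique_mean_eq m (hsub hm)).imp_left
      fun h ⟨c₁, c₀, hc₁, haff⟩ => h ⟨c₁, c₀, hc₁, fun m hm => haff m (hsub hm)⟩
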